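/- Let $n\ge 5$ be an integer, $0<\alpha<1$, let $\hat\tau\ge 1$ be real and let $a\ge 0$ be an integer. Let $\pi$ be a probability distribution on a finite set $S$, let $g:S\to[0,1]$, $\bar g:=\sum_{s}g(s)\pi(s)$, and let $K$ be a transition matrix on $S$ that is reversible with respect to $\pi$: $\pi_iK_{ij}=\pi_jK_{ji}$ for all $i,j$ ($K$ need not be irreducible). Let $\tau_2:=(1-\lambda_2)^{-1}\in(0,\infty]$ be the relaxation time, where $1=\lambda_1\ge\lambda_2\ge\cdots$ are the real eigenvalues of $K$, repeated according to multiplicity (all eigenvalues are real if $\pi>0$; if $|S|=1$, put $\lambda_2:=-1$). Consider $2n$ independent Markov chains with transition matrix $K$, each started from an exact sample from $\pi$, so that there are $2n$ exact samples. There is an adaptive procedure that depends only on $n,\alpha,\hat\tau,a$ (and not on $S,\pi,g,K$), that observes the values of $g$ along the chains, and that works in levels $k=0,1,\dots,a$, as follows. At level $k$ it has run each of the $2n$ chains for $\lfloor n2^k\hat\tau\rfloor$ steps; from the values of $g$ seen so far it decides whether to stop, and it stops at level $a$ at the latest. If $T\in\{0,\dots,a\}$ is the level at which it stops and $M:=2^T\hat\tau\in\{\hat\tau,2\hat\tau,\dots,2^a\hat\tau\}$,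 it has thus used $2n\lfloor nM\rfloor$ steps of the chain in all (that is, $2n^2M$ steps if $n\hat\tau$ is an integer, and at most $2n^2M$ otherwise). It then reports a closed interval $I$ computed from the values of $g$ that it has seen, and 1. $\displaystyle \mathbf P(\bar g\notin I)\le\alpha$; 2. $\displaystyle \operatorname{length}(I)\le k_\alpha^a\,\frac{\log n}{n}$ whenever $1\le M/\hat\tau<2^a$, where $k_\alpha^a:=2\left(\sqrt{2(a+1)/\alpha}+\log\bigl(4(a+1)/\alpha\bigr)\right)$; 3. $\displaystyle \mathbf P\bigl(M>96\max(\tau_2,\hat\tau)\bigr)\le 3n(n+1)\exp(-\log^2 n)$, where $\log^2 n=(\log n)^2$. -/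

import Mathlib

open MeasureTheory ProbabilityTheory

noncomputable section

namespace AdaptiveMCMC

/-- Detailed balance: `K` is reversible with respect to `π`. -/
def IsReversible {S : Type*} (π : S → ℝ) (K : Matrix S S ℝ) : Prop :=
  ∀ i j, π i * K i j = π j * K j i

/-- The eigenvalue `λ₂`: the second entry of the list of the (real) eigenvalues of `K`, repeated
according to multiplicity, in decreasing order `λ₁ ≥ λ₂ ≥ ⋯`. A one-state chain has no `λ₂`, and
the value is then set to `-1`. -/
def secondEigenvalue {S : Type*} [Fintype S] [DecidableEq S] (K : Matrix S S ℝ) : ℝ :=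
  (K.charpoly.roots.sort (fun x y => y ≤ x)).getD 1 (-1)

/-- The relaxation time `τ₂ = (1 - λ₂)⁻¹ ∈ [0, ∞]`, which is `∞` if `λ₂ = 1`. -/
def relaxationTime {S : Type*} [Fintype S] [DecidableEq S] (K : Matrix S S ℝ) : ENNReal :=
  (ENNReal.ofReal (1 - secondEigenvalue K))⁻¹

/-- `X 0, X 1, …` is a Markov chain with initial law `π` and transition matrix `K`. -/
structure IsMarkovChain {S Ω : Type*} [MeasurableSpace S] [MeasurableSpace Ω] (μ : Measure Ω)
    (π : S → ℝ) (K : Matrix S S ℝ) (X : ℕ → Ω → S) : Prop where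
  measurable : ∀ j, Measurable (X j)
  law : ∀ (L : ℕ) (x : ℕ → S),
    μ {ω | ∀ j ≤ L, X j ω = x j} =
      ENNReal.ofReal (π (x 0) * ∏ j ∈ Finset.range L, K (x j) (x (j + 1)))

/-- A procedure that observes real-valued sequences indexed by `ι` at levels `k = 0, …, a`. At
level `k` it has seen the first `steps k` steps (the entries `0, …, steps k`) of every sequence.
From what it has seen so far it decides whether to stop, and stops at level `a` at the latest; on
stopping at level `k` it reports an interval `[lo k, hi k]` computed from what it has seen. -/
structure Procedure (ι : Type*) (steps : ℕ → ℕ) (a : ℕ) where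
  halt : (k : ℕ) → (ι → Fin (steps k + 1) → ℝ) → Prop
  lo : (k : ℕ) → (ι → Fin (steps k + 1) → ℝ) → ℝ
  hi : (k : ℕ) → (ι → Fin (steps k + 1) → ℝ) → ℝ
  lo_le_hi : ∀ k y, lo k y ≤ hi k y

namespace Procedure

variable {ι : Type*} {steps : ℕ → ℕ} {a : ℕ}

/-- The part of the sequences `y` that is seen at level `k`. -/
def seen (_P : Procedure ι steps a) (y : ι → ℕ → ℝ) (k : ℕ) : ι → Fin (steps k + 1) → ℝ :=
  fun i j => y i j

/-- The level at which the procedure stops: the first one at which it decides to stop, and `a` if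
there is none before `a`. -/
def level (P : Procedure ι steps a) (y : ι → ℕ → ℝ) : ℕ :=
  sInf {k | k = a ∨ P.halt k (P.seen y k)}

/-- The left end of the reported interval. -/
def left (P : Procedure ι steps a) (y : ι → ℕ → ℝ) : ℝ :=
  P.lo (P.level y) (P.seen y (P.level y))

/-- The right end of the reported interval. -/
def right (P : Procedure ι steps a) (y : ι → ℕ → ℝ) : ℝ :=
  P.hi (P.level y) (P.seen y (P.level y))

/-- The number of steps of each single sequence that the procedure has used when it stops. -/
def stepsUsed (P : Procedure ι steps a) (y : ι → ℕ → ℝ) : ℕ :=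
  steps (P.level y)

end Procedure

end AdaptiveMCMC

end

noncomputable section

namespace AdaptiveMCMC

open Matrix

/-! At each level the averages of `g` along the `2n` chains are i.i.d. in `[0,1]`, with mean `gbar`
and some variance `v`. One half of the chains tests whether `v` is small: the procedure stops once
`spread`, a sum of squared differences over disjoint pairs, is at most `log² n / 2`. The other half
estimates `gbar`. The two halves are independent, so looking at the test does not bias the estimate.

Validity: an error at a given level needs both a small spread and a bad centre, and these
probabilities multiply. If `n v ≤ 2 log² n`, Chebyshev for the centre suffices; otherwise Chebyshev
for the spread makes stopping unlikely enough to compensate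
(`measureReal_spread_le_and_lt_abs_center_sub_le`). Each level gets the error budget `α / (a + 1)`,
and a union bound over the levels gives `α`.

Running time: by the spectral decomposition of a reversible matrix, `v ≤ 4 τ₂ / N` for averages over
`N` states (`averageVariance_le`). At the first level with `2 ^ k * τhat > 48 max(τ₂, τhat)` this
gives `n v ≤ 1/12`, and an exponential Markov bound makes a large spread improbable
(`measureReal_lt_spread_le`). Running beyond `96 max(τ₂, τhat)` means having gone on after that
single level, so no union bound is needed. -/

/-! ### The spectrum of a reversible matrix. -/

/-- In a decreasing list at most one entry exceeds the second one, so `x` and `y`, counted with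
multiplicity, cannot both do so. The default `d` plays no role, since the list has at least two
entries. -/
theorem min_le_getD_sort {s : Multiset ℝ} {x y : ℝ} (h : ({x, y} : Multiset ℝ) ≤ s) (d : ℝ) :
    min x y ≤ (s.sort (fun x y => y ≤ x)).getD 1 d := by
  have hs : ((s.sort (fun x y => y ≤ x) : List ℝ) : Multiset ℝ) = s := Multiset.sort_eq s _
  have hp := Multiset.pairwise_sort s (fun x y => y ≤ x)
  generalize s.sort (fun x y => y ≤ x) = l at hs hp
  subst hs
  match l, h, hp with
  | [], h, _ => simpa using Multiset.card_le_card h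
  | [p], h, _ => simpa using Multiset.card_le_card h
  | p :: q :: t, h, hp =>
    simp only [List.getD_cons_succ, List.getD_cons_zero]
    by_contra! hlt
    obtain ⟨hx, hy⟩ := lt_min_iff.1 hlt
    have h1 := Multiset.card_le_card (Multiset.filter_le_filter (fun z => q < z) h)
    have h2 : t.filter (fun z => decide (q < z)) = [] := by
      rw [List.filter_eq_nil_iff]
      intro z hz
      have := (List.pairwise_cons.1 (List.pairwise_cons.1 hp).2).1 z hz
      simpa using this
    have h3 : Multiset.card (Multiset.filter (fun z => q < z) ({x, y} : Multiset ℝ)) = 2 := by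
      rw [Multiset.filter_eq_self.2]
      · rfl
      · intro z hz
        rcases Multiset.mem_cons.1 hz with rfl | hz
        · exact hx
        · rw [Multiset.mem_singleton.1 hz]; exact hy
    rw [h3, Multiset.filter_coe, Multiset.coe_card] at h1
    simp only [List.filter_cons, lt_irrefl, decide_false, h2] at h1
    split_ifs at h1 <;> simp_all

section Spectral

variable {S : Type*} {π : S → ℝ} {K : Matrix S S ℝ}

/-- The restriction of `K` to the support of `π`, symmetrized. -/
def symmetrization (π : S → ℝ) (K : Matrix S S ℝ) : Matrix {s // 0 < π s} {s // 0 < π s} ℝ :=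
  Matrix.of fun i j => √(π i) * K i j / √(π j)

theorem IsReversible.isHermitian_symmetrization (h : IsReversible π K) :
    (symmetrization π K).IsHermitian := by
  ext i j
  have hi := Real.sqrt_pos.2 i.2
  have hj := Real.sqrt_pos.2 j.2
  simp only [conjTranspose_apply, symmetrization, of_apply, star_trivial]
  rw [div_eq_div_iff hi.ne' hj.ne']
  have := h i j
  rw [← Real.mul_self_sqrt i.2.le, ← Real.mul_self_sqrt j.2.le] at this
  linear_combination -this

theorem IsReversible.eq_zero (h : IsReversible π K) {i j : S} (hi : 0 < π i) (hj : π j = 0) :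
    K i j = 0 := by
  have := h i j
  rw [hj, zero_mul] at this
  exact (mul_eq_zero.1 this).resolve_left hi.ne'

variable [Fintype S]

theorem sum_support_eq (F : S → ℝ) (hF : ∀ s, ¬ 0 < π s → F s = 0) :
    ∑ s : {s // 0 < π s}, F s = ∑ s, F s := by
  rw [← Fintype.sum_subtype_add_sum_subtype (fun s => 0 < π s) F,
    Finset.sum_eq_zero (s := (Finset.univ : Finset {s // ¬ 0 < π s})) fun s _ => hF s s.2, add_zero]

/-- `f`, weighted by the square root of `π`, on the support of `π`. -/
def weighted (π f : S → ℝ) : {s // 0 < π s} → ℝ := fun s => √(π s) * f s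

theorem IsReversible.sum_support (h : IsReversible π K) (hπ : ∀ s, 0 ≤ π s)
    (f : S → ℝ) (i : {s // 0 < π s}) : ∑ j : {s // 0 < π s}, K i j * f j = (K *ᵥ f) i :=
  sum_support_eq (fun j => K i j * f j) fun j hj => by
    rw [h.eq_zero i.2 (le_antisymm (not_lt.1 hj) (hπ j)), zero_mul]

theorem weighted_dotProduct (hπ : ∀ s, 0 ≤ π s) (f g : S → ℝ) :
    weighted π f ⬝ᵥ weighted π g = ∑ s, π s * (f s * g s) := by
  rw [← sum_support_eq (π := π) (fun s => π s * (f s * g s)) fun s hs => by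
    rw [le_antisymm (not_lt.1 hs) (hπ s), zero_mul]]
  refine Finset.sum_congr rfl fun s _ => ?_
  simp only [weighted]
  rw [mul_mul_mul_comm, Real.mul_self_sqrt (hπ s)]

theorem IsReversible.symmetrization_mulVec (h : IsReversible π K) (hπ : ∀ s, 0 ≤ π s)
    (f : S → ℝ) : symmetrization π K *ᵥ weighted π f = weighted π (K *ᵥ f) := by
  ext i
  rw [weighted, ← h.sum_support hπ, mulVec, dotProduct, Finset.mul_sum]
  refine Finset.sum_congr rfl fun j _ => ?_
  have hj := Real.sqrt_pos.2 j.2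
  simp only [symmetrization, of_apply, weighted]
  field_simp

variable [DecidableEq S]

/-- The two matrices are conjugate by the diagonal matrix of the `√π i`. -/
theorem charpoly_symmetrization (π : S → ℝ) (K : Matrix S S ℝ) :
    (symmetrization π K).charpoly = (K.toSquareBlockProp fun s => 0 < π s).charpoly := by
  set D : Matrix {s // 0 < π s} {s // 0 < π s} ℝ := diagonal fun i => √(π i)
  set E : Matrix {s // 0 < π s} {s // 0 < π s} ℝ := diagonal fun i => (√(π i))⁻¹
  have h1 : symmetrization π K = (D * K.toSquareBlockProp fun s => 0 < π s) * E := by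
    ext i j
    rw [mul_diagonal, diagonal_mul]
    rfl
  have h2 : E * D = 1 := by
    rw [diagonal_mul_diagonal, ← diagonal_one]
    congr 1
    ext i
    exact inv_mul_cancel₀ (Real.sqrt_pos.2 i.2).ne'
  rw [h1, charpoly_mul_comm, ← Matrix.mul_assoc, h2, Matrix.one_mul]

/-- Detailed balance forbids steps from the support of `π` out of it, so `K` is block triangular.
This handles a `π` with zeros, where `K` itself need not be symmetrizable. -/
theorem IsReversible.charpoly_symmetrization_dvd (h : IsReversible π K) (hπ : ∀ s, 0 ≤ π s) :
    (symmetrization π K).charpoly ∣ K.charpoly := by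
  rw [charpoly_symmetrization]
  refine ⟨(K.toSquareBlockProp fun s => ¬ 0 < π s).charpoly, ?_⟩
  rw [charpoly, twoBlockTriangular_det' _ (fun s => 0 < π s)]
  · congr 1
    · congr 1
      ext i j : 2
      simp [toSquareBlockProp, charmatrix_apply, diagonal_apply, Subtype.ext_iff]
    · congr 1
      ext i j : 2
      simp [toSquareBlockProp, charmatrix_apply, diagonal_apply, Subtype.ext_iff]
  · intro i hi j hj
    have hij : i ≠ j := by rintro rfl; exact hj hi
    rw [charmatrix_apply_ne _ _ _ hij, h.eq_zero hi (le_antisymm (not_lt.1 hj) (hπ j))]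
    simp

/-- By divisibility of the characteristic polynomials, the two eigenvalues form a sub-multiset of
the real roots for `K`. -/
theorem IsReversible.min_eigenvalues_le (h : IsReversible π K) (hπ : ∀ s, 0 ≤ π s)
    {i j : {s // 0 < π s}} (hij : i ≠ j) :
    min (h.isHermitian_symmetrization.eigenvalues i) (h.isHermitian_symmetrization.eigenvalues j)
      ≤ secondEigenvalue K := by
  apply min_le_getD_sort
  refine le_trans ?_ (Polynomial.roots.le_of_dvd (charpoly_monic K).ne_zero
    (h.charpoly_symmetrization_dvd hπ))
  rw [h.isHermitian_symmetrization.roots_charpoly_eq_eigenvalues]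
  have : ({i, j} : Multiset {s // 0 < π s}) ≤ Finset.univ.val := by
    rw [Multiset.le_iff_subset]
    · intro x _; exact Finset.mem_univ_val x
    · simpa using hij
  simpa using Multiset.map_le_map
    (f := fun i => ((h.isHermitian_symmetrization.eigenvalues i : ℝ))) this

theorem IsReversible.symmetrization_pow_mulVec (h : IsReversible π K) (hπ : ∀ s, 0 ≤ π s)
    (f : S → ℝ) (d : ℕ) :
    (symmetrization π K) ^ d *ᵥ weighted π f = weighted π (K ^ d *ᵥ f) := by
  induction d with
  | zero => simp
  | succ d ih => rw [pow_succ', ← mulVec_mulVec, ih, h.symmetrization_mulVec hπ, mulVec_mulVec,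
      pow_succ']

theorem sum_eigenvectorBasis_dotProduct {ι : Type*} [Fintype ι] [DecidableEq ι]
    {A : Matrix ι ι ℝ} (hA : A.IsHermitian) (x y : ι → ℝ) :
    ∑ i, (⇑(hA.eigenvectorBasis i) ⬝ᵥ x) * (⇑(hA.eigenvectorBasis i) ⬝ᵥ y) = x ⬝ᵥ y := by
  have := hA.eigenvectorBasis.sum_inner_mul_inner (WithLp.toLp 2 x) (WithLp.toLp 2 y)
  simp only [EuclideanSpace.inner_eq_star_dotProduct, star_trivial] at this
  rw [dotProduct_comm x y, ← this]
  refine Finset.sum_congr rfl fun i _ => ?_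
  rw [dotProduct_comm y]

theorem eigenvectorBasis_dotProduct_mulVec {ι : Type*} [Fintype ι] [DecidableEq ι]
    {A : Matrix ι ι ℝ} (hA : A.IsHermitian) (i : ι) (x : ι → ℝ) :
    ⇑(hA.eigenvectorBasis i) ⬝ᵥ (A *ᵥ x) =
      hA.eigenvalues i * (⇑(hA.eigenvectorBasis i) ⬝ᵥ x) := by
  have hT : Aᵀ = A := by ext i j; exact hA.apply i j
  rw [dotProduct_mulVec, ← mulVec_transpose, hT, hA.mulVec_eigenvectorBasis, smul_dotProduct,
    smul_eq_mul]

theorem eigenvectorBasis_dotProduct_pow_mulVec {ι : Type*} [Fintype ι] [DecidableEq ι]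
    {A : Matrix ι ι ℝ} (hA : A.IsHermitian) (i : ι) (x : ι → ℝ) (d : ℕ) :
    ⇑(hA.eigenvectorBasis i) ⬝ᵥ (A ^ d *ᵥ x) =
      hA.eigenvalues i ^ d * (⇑(hA.eigenvectorBasis i) ⬝ᵥ x) := by
  induction d with
  | zero => simp
  | succ d ih =>
    rw [pow_succ', ← mulVec_mulVec, eigenvectorBasis_dotProduct_mulVec, ih, pow_succ', mul_assoc]

/-- Maximum principle: evaluate the eigenvalue equation where `|v| / √π` is largest; row sums over
the support are at most `1`, whence `|θ| ≤ 1`. -/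
theorem IsReversible.neg_one_le_eigenvalues (h : IsReversible π K)
    (hK : K ∈ Matrix.rowStochastic ℝ S) (i : {s // 0 < π s}) :
    -1 ≤ h.isHermitian_symmetrization.eigenvalues i := by
  set hA := h.isHermitian_symmetrization
  set v : {s // 0 < π s} → ℝ := ⇑(hA.eigenvectorBasis i)
  set θ := hA.eigenvalues i
  have hv : symmetrization π K *ᵥ v = θ • v := hA.mulVec_eigenvectorBasis i
  have hne : ∃ s, v s ≠ 0 := by
    by_contra! hz
    have h0 : hA.eigenvectorBasis i = 0 := by ext s; exact hz s
    have := hA.eigenvectorBasis.orthonormal.1 i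
    simp [h0] at this
  obtain ⟨s₀, hs₀⟩ := hne
  obtain ⟨s, -, hs⟩ := Finset.exists_max_image Finset.univ (fun s => |v s| / √(π s))
    ⟨s₀, Finset.mem_univ _⟩
  have hr : ∀ s : {s // 0 < π s}, 0 < √(π s) := fun s => Real.sqrt_pos.2 s.2
  have hpos : 0 < |v s| / √(π s) :=
    lt_of_lt_of_le (div_pos (abs_pos.2 hs₀) (hr s₀)) (hs s₀ (Finset.mem_univ _))
  have h1 : θ * v s / √(π s) = ∑ t : {s // 0 < π s}, K s t * (v t / √(π t)) := by
    have := congrFun hv s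
    rw [Pi.smul_apply, smul_eq_mul] at this
    rw [← this, mulVec, dotProduct, Finset.sum_div]
    refine Finset.sum_congr rfl fun t _ => ?_
    simp only [symmetrization, of_apply]
    have := hr s
    have := hr t
    field_simp
  have h2 : |θ| * (|v s| / √(π s)) ≤ |v s| / √(π s) := by
    calc |θ| * (|v s| / √(π s)) = |θ * v s / √(π s)| := by
          rw [abs_div, abs_mul, abs_of_pos (hr s), mul_div_assoc]
      _ ≤ ∑ t : {s // 0 < π s}, |K s t * (v t / √(π t))| := by
          rw [h1]; exact Finset.abs_sum_le_sum_abs _ _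
      _ ≤ ∑ t : {s // 0 < π s}, K s t * (|v s| / √(π s)) := by
          refine Finset.sum_le_sum fun t _ => ?_
          rw [abs_mul, abs_div, abs_of_nonneg (hK.1 s t), abs_of_pos (hr t)]
          exact mul_le_mul_of_nonneg_left (hs t (Finset.mem_univ _)) (hK.1 s t)
      _ ≤ 1 * (|v s| / √(π s)) := by
          rw [← Finset.sum_mul]
          refine mul_le_mul_of_nonneg_right ?_ hpos.le
          rw [← sum_row_of_mem_rowStochastic hK s,
            ← Fintype.sum_subtype_add_sum_subtype (fun t => 0 < π t) (fun t => K s t)]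
          exact le_add_of_nonneg_right (Finset.sum_nonneg fun t _ => hK.1 s t)
      _ = _ := one_mul _
  exact (abs_le.1 (le_of_mul_le_mul_right (by rwa [one_mul]) hpos)).1

/-- If `λ₂ < 1` then the autocovariances of a centred observable of the stationary chain are a
mixture of powers of eigenvalues in `[-1, λ₂]`. -/
theorem IsReversible.exists_autocovariance_eq (h : IsReversible π K)
    (hπ : π ∈ stdSimplex ℝ S) (hK : K ∈ Matrix.rowStochastic ℝ S)
    (hgap : secondEigenvalue K < 1) {f : S → ℝ} (hf : ∑ s, π s * f s = 0) :
    ∃ c θ : {s // 0 < π s} → ℝ, (∀ i, 0 ≤ c i) ∧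
      (∀ i, c i = 0 ∨ (-1 ≤ θ i ∧ θ i ≤ secondEigenvalue K)) ∧
      ∀ d, ∑ s, π s * (f s * (K ^ d *ᵥ f) s) = ∑ i, c i * θ i ^ d := by
  set hA := h.isHermitian_symmetrization
  set U : {s // 0 < π s} → {s // 0 < π s} → ℝ := fun i => ⇑(hA.eigenvectorBasis i)
  set w := weighted π 1
  -- The vector `w = √π` is fixed by the symmetrization, so it has components only along eigenvalue
  -- `1`.
  have hw : ∀ i, hA.eigenvalues i * (U i ⬝ᵥ w) = U i ⬝ᵥ w := fun i => by
    rw [← eigenvectorBasis_dotProduct_mulVec, h.symmetrization_mulVec hπ.1, hK.2]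
  have hww : ∑ i, (U i ⬝ᵥ w) * (U i ⬝ᵥ w) = 1 := by
    rw [sum_eigenvectorBasis_dotProduct, weighted_dotProduct hπ.1]
    simpa using hπ.2
  have hwf : ∑ i, (U i ⬝ᵥ w) * (U i ⬝ᵥ weighted π f) = 0 := by
    rw [sum_eigenvectorBasis_dotProduct, weighted_dotProduct hπ.1]
    simpa using hf
  obtain ⟨i₀, hi₀⟩ : ∃ i, U i ⬝ᵥ w ≠ 0 := by
    by_contra! hz
    simp [hz] at hww
  have hθ₀ : hA.eigenvalues i₀ = 1 := mul_right_cancel₀ hi₀ (by rw [hw, one_mul])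
  -- The index `i₀` carries eigenvalue `1 > λ₂`; any other index paired with it must have its
  -- eigenvalue at most `λ₂`. Hence `w` is a multiple of the basis vector `i₀`, and centring `f`
  -- kills its component there.
  have hθ : ∀ i, i ≠ i₀ → hA.eigenvalues i ≤ secondEigenvalue K := fun i hi => by
    have := h.min_eigenvalues_le hπ.1 hi
    change min (hA.eigenvalues i) (hA.eigenvalues i₀) ≤ _ at this
    rw [hθ₀] at this
    exact (min_le_iff.1 this).resolve_right (not_le.2 hgap)
  have hU : ∀ i, i ≠ i₀ → U i ⬝ᵥ w = 0 := fun i hi => by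
    by_contra hne
    have : hA.eigenvalues i = 1 := mul_right_cancel₀ hne (by rw [hw, one_mul])
    linarith [hθ i hi]
  have hf₀ : U i₀ ⬝ᵥ weighted π f = 0 := by
    rw [Finset.sum_eq_single i₀ (fun i _ hi => by rw [hU i hi, zero_mul]) (by simp)] at hwf
    exact (mul_eq_zero.1 hwf).resolve_left hi₀
  refine ⟨fun i => (U i ⬝ᵥ weighted π f) ^ 2, hA.eigenvalues, fun i => sq_nonneg _, fun i => ?_,
    fun d => ?_⟩
  · by_cases hi : i = i₀
    · left; simp [hi, hf₀]
    · exact Or.inr ⟨h.neg_one_le_eigenvalues hK i, hθ i hi⟩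
  · rw [← weighted_dotProduct hπ.1, ← h.symmetrization_pow_mulVec hπ.1,
      ← sum_eigenvectorBasis_dotProduct hA]
    refine Finset.sum_congr rfl fun i _ => ?_
    rw [eigenvectorBasis_dotProduct_pow_mulVec]
    ring

end Spectral

/-! ### Geometric sums over pairs of times. -/

theorem geom_sum_le_two_div {θ : ℝ} (h₁ : -1 ≤ θ) (h₂ : θ < 1) (N : ℕ) :
    ∑ d ∈ Finset.range N, θ ^ d ≤ 2 / (1 - θ) := by
  have h : 0 < 1 - θ := by linarith
  have h' : |θ ^ N| ≤ 1 := by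
    rw [abs_pow]
    exact pow_le_one₀ (abs_nonneg θ) (abs_le.2 ⟨h₁, h₂.le⟩)
  rw [le_div_iff₀ h, geom_sum_mul_neg]
  linarith [(abs_le.1 h').1]

/-- With truncated subtraction the exponent is `|i - j|`. Each row splits at `i` into two geometric
sums, each at most `2 / (1 - θ)`; no bound on `θ` away from `-1` is needed. -/
theorem sum_pow_dist_le {θ : ℝ} (h₁ : -1 ≤ θ) (h₂ : θ < 1) (N : ℕ) :
    ∑ i ∈ Finset.range N, ∑ j ∈ Finset.range N, θ ^ (i - j + (j - i)) ≤ N * (4 / (1 - θ)) := by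
  rw [← nsmul_eq_mul, ← Finset.card_range N, Finset.card_range]
  conv_rhs => rw [← Finset.card_range N]
  refine Finset.sum_le_card_nsmul _ _ _ fun i hi => ?_
  have hi := Finset.mem_range.1 hi
  rw [← Finset.sum_range_add_sum_Ico _ hi.le]
  have e1 : ∑ j ∈ Finset.range i, θ ^ (i - j + (j - i)) =
      ∑ d ∈ Finset.range (i + 1), θ ^ d - 1 := by
    rw [Finset.sum_range_succ', pow_zero, add_sub_cancel_right, ← Finset.sum_range_reflect]
    refine Finset.sum_congr rfl fun j hj => ?_
    have := Finset.mem_range.1 hj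
    congr 1
    omega
  have e2 : ∑ j ∈ Finset.Ico i N, θ ^ (i - j + (j - i)) = ∑ d ∈ Finset.range (N - i), θ ^ d := by
    rw [Finset.sum_Ico_eq_sum_range]
    refine Finset.sum_congr rfl fun j _ => ?_
    congr 1
    omega
  rw [e1, e2]
  have := geom_sum_le_two_div h₁ h₂ (i + 1)
  have := geom_sum_le_two_div h₁ h₂ (N - i)
  have : 4 / (1 - θ) = 2 / (1 - θ) + 2 / (1 - θ) := by ring
  linarith

/-! ### Moments of the stationary chain. -/

theorem integral_comp_eq_sum {T Ω : Type*} [Fintype T] [MeasurableSpace T]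
    [MeasurableSingletonClass T] [MeasurableSpace Ω] {μ : Measure Ω} [IsFiniteMeasure μ]
    {Y : Ω → T} (hY : Measurable Y) (F : T → ℝ) :
    ∫ ω, F (Y ω) ∂μ = ∑ t, μ.real (Y ⁻¹' {t}) * F t := by
  rw [← integral_map hY.aemeasurable (f := F) (measurable_of_finite F).aestronglyMeasurable,
    integral_fintype .of_finite]
  refine Finset.sum_congr rfl fun t _ => ?_
  rw [map_measureReal_apply hY (measurableSet_singleton t), smul_eq_mul]

theorem IsReversible.vecMul_eq {S : Type*} [Fintype S] [DecidableEq S] {π : S → ℝ}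
    {K : Matrix S S ℝ} (h : IsReversible π K) (hK : K ∈ Matrix.rowStochastic ℝ S) :
    π ᵥ* K = π := by
  ext j
  rw [vecMul, dotProduct, Finset.sum_congr rfl fun i _ => h i j, ← Finset.mul_sum,
    sum_row_of_mem_rowStochastic hK, mul_one]

theorem dotProduct_pow_mulVec {S : Type*} [Fintype S] [DecidableEq S] {π : S → ℝ}
    {K : Matrix S S ℝ} (h : π ᵥ* K = π) (ψ : S → ℝ) (d : ℕ) : π ⬝ᵥ (K ^ d *ᵥ ψ) = π ⬝ᵥ ψ := by
  induction d with
  | zero => simp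
  | succ d ih => rw [pow_succ', ← mulVec_mulVec, dotProduct_mulVec, h, ih]

namespace IsMarkovChain

variable {S Ω : Type*} [MeasurableSpace S] [MeasurableSpace Ω] {μ : Measure Ω} {π : S → ℝ}
  {K : Matrix S S ℝ} {X : ℕ → Ω → S}

theorem measureReal_path (hX : IsMarkovChain μ π K X) (hπ : ∀ s, 0 ≤ π s)
    (hK : ∀ s t, 0 ≤ K s t) (L : ℕ) (x : ℕ → S) :
    μ.real {ω | ∀ j ≤ L, X j ω = x j} =
      π (x 0) * ∏ j ∈ Finset.range L, K (x j) (x (j + 1)) := by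
  rw [measureReal_def, hX.law,
    ENNReal.toReal_ofReal (mul_nonneg (hπ _) (Finset.prod_nonneg fun j _ => hK _ _))]

variable [Fintype S] [DiscreteMeasurableSpace S] [IsProbabilityMeasure μ]

theorem integrable_comp (hX : IsMarkovChain μ π K X) (F : S → S → ℝ) (i j : ℕ) :
    Integrable (fun ω => F (X i ω) (X j ω)) μ := by
  have hm : Measurable fun ω => (X i ω, X j ω) := (hX.measurable i).prodMk (hX.measurable j)
  exact (Integrable.of_finite (f := fun p : S × S => F p.1 p.2)
    (μ := μ.map fun ω => (X i ω, X j ω))).comp_measurable hm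

/-- The Markov property, tested against functions of the past. -/
theorem integral_mul_comp_succ (hX : IsMarkovChain μ π K X) (hπ : ∀ s, 0 ≤ π s)
    (hK : ∀ s t, 0 ≤ K s t) (L : ℕ) (Φ : (Fin (L + 1) → S) → ℝ) (h : S → ℝ) :
    ∫ ω, Φ (fun j => X j ω) * h (X (L + 1) ω) ∂μ =
      ∫ ω, Φ (fun j => X j ω) * (K *ᵥ h) (X L ω) ∂μ := by
  have hm : Measurable fun ω (j : Fin (L + 1)) => X j ω :=
    measurable_pi_lambda _ fun j => hX.measurable j
  have e1 := integral_comp_eq_sum (μ := μ) (hm.prodMk (hX.measurable (L + 1)))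
    (fun p => Φ p.1 * h p.2)
  have e2 := integral_comp_eq_sum (μ := μ) hm (fun w => Φ w * (K *ᵥ h) (w (Fin.last L)))
  simp only [Fin.val_last] at e1 e2
  rw [e1, e2, Fintype.sum_prod_type]
  refine Finset.sum_congr rfl fun w _ => ?_
  rw [mulVec, dotProduct, Finset.mul_sum, Finset.mul_sum]
  refine Finset.sum_congr rfl fun t _ => ?_
  set x : ℕ → S := fun j => if hj : j < L + 1 then w ⟨j, hj⟩ else t with hx
  have hxw : ∀ j : Fin (L + 1), x j = w j := fun j => by
    simp only [hx, dif_pos j.2]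
  have hxt : x (L + 1) = t := by simp [hx]
  have s1 : (fun ω (j : Fin (L + 1)) => X j ω) ⁻¹' {w} = {ω | ∀ j ≤ L, X j ω = x j} := by
    ext ω
    simp only [Set.mem_preimage, Set.mem_singleton_iff, Set.mem_ofPred_eq, funext_iff, ← hxw]
    exact ⟨fun H j hj => H ⟨j, Nat.lt_succ_of_le hj⟩, fun H j => H j (Nat.le_of_lt_succ j.2)⟩
  have s2 : (fun ω => ((fun j : Fin (L + 1) => X j ω), X (L + 1) ω)) ⁻¹' {(w, t)} =
      {ω | ∀ j ≤ L + 1, X j ω = x j} := by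
    ext ω
    have := congrArg (ω ∈ ·) s1
    simp only [Set.mem_preimage, Set.mem_singleton_iff, Set.mem_ofPred_eq, Prod.mk.injEq] at this ⊢
    rw [this, ← hxt]
    exact ⟨fun H j hj => (Nat.le_succ_iff.1 hj).elim (H.1 j) fun e => e ▸ H.2,
      fun H => ⟨fun j hj => H j (hj.trans L.le_succ), H _ le_rfl⟩⟩
  rw [s1, s2, hX.measureReal_path hπ hK, hX.measureReal_path hπ hK, Finset.prod_range_succ, hxt,
    show x L = w (Fin.last L) from hxw (Fin.last L)]
  ring

variable [DecidableEq S]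

/-- Each use of the Markov property removes the last step and moves one factor `K` onto `h`. -/
theorem integral_mul_comp_add (hX : IsMarkovChain μ π K X) (hπ : ∀ s, 0 ≤ π s)
    (hK : ∀ s t, 0 ≤ K s t) (i d : ℕ) (φ h : S → ℝ) :
    ∫ ω, φ (X i ω) * h (X (i + d) ω) ∂μ = ∫ ω, φ (X i ω) * (K ^ d *ᵥ h) (X i ω) ∂μ := by
  induction d generalizing h with
  | zero => simp
  | succ d ih =>
    have := hX.integral_mul_comp_succ hπ hK (i + d) (fun w => φ (w ⟨i, by omega⟩)) h
    rw [← add_assoc, this, ih, mulVec_mulVec, pow_succ]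

variable (hX : IsMarkovChain μ π K X) (hπ : ∀ s, 0 ≤ π s) (hK : K ∈ Matrix.rowStochastic ℝ S)
  (hrev : IsReversible π K)
include hX hπ hK hrev

theorem integral_comp (i : ℕ) (ψ : S → ℝ) : ∫ ω, ψ (X i ω) ∂μ = ∑ s, π s * ψ s := by
  have h0 : ∀ ψ : S → ℝ, ∫ ω, ψ (X 0 ω) ∂μ = ∑ s, π s * ψ s := fun ψ => by
    rw [integral_comp_eq_sum (hX.measurable 0)]
    refine Finset.sum_congr rfl fun s _ => ?_
    have := hX.measureReal_path hπ hK.1 0 fun _ => s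
    simp only [Nat.le_zero, forall_eq, Finset.range_zero, Finset.prod_empty, mul_one] at this
    rw [← this]
    rfl
  have := hX.integral_mul_comp_add hπ hK.1 0 i 1 ψ
  simp only [Pi.one_apply, one_mul, zero_add] at this
  rw [this, h0]
  exact dotProduct_pow_mulVec (hrev.vecMul_eq hK) ψ i

theorem integral_mul_comp (i j : ℕ) (f : S → ℝ) :
    ∫ ω, f (X i ω) * f (X j ω) ∂μ =
      ∑ s, π s * (f s * (K ^ (i - j + (j - i)) *ᵥ f) s) := by
  rcases le_total i j with h | h
  · obtain ⟨d, rfl⟩ := Nat.exists_eq_add_of_le h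
    rw [hX.integral_mul_comp_add hπ hK.1, hX.integral_comp hπ hK hrev i
      (fun s => f s * (K ^ d *ᵥ f) s)]
    simp
  · obtain ⟨d, rfl⟩ := Nat.exists_eq_add_of_le h
    simp_rw [mul_comm (f (X (j + d) _))]
    rw [hX.integral_mul_comp_add hπ hK.1, hX.integral_comp hπ hK hrev j
      (fun s => f s * (K ^ d *ᵥ f) s)]
    simp

end IsMarkovChain

/-- The variance of the average of `g` over `N` successive states of a stationary chain. -/
def averageVariance {S : Type*} [Fintype S] [DecidableEq S] (π : S → ℝ) (K : Matrix S S ℝ)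
    (g : S → ℝ) (N : ℕ) : ℝ :=
  (∑ i ∈ Finset.range N, ∑ j ∈ Finset.range N,
    ∑ s, π s * ((g s - ∑ t, g t * π t) *
      (K ^ (i - j + (j - i)) *ᵥ fun r => g r - ∑ t, g t * π t) s)) / (N : ℝ) ^ 2

namespace IsMarkovChain

variable {S Ω : Type*} [Fintype S] [DecidableEq S] [MeasurableSpace S] [DiscreteMeasurableSpace S]
  [MeasurableSpace Ω] {μ : Measure Ω} [IsProbabilityMeasure μ] {π : S → ℝ} {K : Matrix S S ℝ}
  {X : ℕ → Ω → S} (hX : IsMarkovChain μ π K X) (hπ : ∀ s, 0 ≤ π s)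
  (hK : K ∈ Matrix.rowStochastic ℝ S) (hrev : IsReversible π K)

include hX hπ hK hrev

theorem integral_average (g : S → ℝ) (N : ℕ) (hN : 0 < N) :
    ∫ ω, (∑ j : Fin N, g (X j ω)) / (N : ℝ) ∂μ = ∑ s, g s * π s := by
  rw [integral_div, integral_finsetSum (f := fun (j : Fin N) ω => g (X j ω)) _ fun j _ =>
    hX.integrable_comp (fun s _ => g s) j 0]
  simp_rw [hX.integral_comp hπ hK hrev _ g]
  rw [Finset.sum_const, Finset.card_univ, Fintype.card_fin, nsmul_eq_mul,
    mul_div_cancel_left₀ _ (by positivity)]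
  exact Finset.sum_congr rfl fun s _ => mul_comm _ _

theorem integral_average_sub_sq (g : S → ℝ) (N : ℕ) (hN : 0 < N) :
    ∫ ω, ((∑ j : Fin N, g (X j ω)) / (N : ℝ) - ∑ s, g s * π s) ^ 2 ∂μ =
      averageVariance π K g N := by
  set f : S → ℝ := fun s => g s - ∑ t, g t * π t with hf
  have hN' : (N : ℝ) ≠ 0 := by positivity
  have e : ∀ ω, ((∑ j : Fin N, g (X j ω)) / (N : ℝ) - ∑ s, g s * π s) ^ 2 =
      (∑ i ∈ Finset.range N, ∑ j ∈ Finset.range N, f (X i ω) * f (X j ω)) / (N : ℝ) ^ 2 := by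
    intro ω
    rw [← Finset.sum_mul_sum, Finset.sum_range, Finset.sum_sub_distrib, Finset.sum_const,
      Finset.card_univ, Fintype.card_fin, nsmul_eq_mul]
    field_simp
  simp_rw [e]
  rw [integral_div, integral_finsetSum (f := fun i ω => ∑ j ∈ Finset.range N, f (X i ω) * f (X j ω)) _
    fun i _ => integrable_finsetSum _ fun j _ =>
    hX.integrable_comp (fun s t => f s * f t) i j, averageVariance]
  congr 1
  refine Finset.sum_congr rfl fun i _ => ?_
  rw [integral_finsetSum (f := fun j ω => f (X i ω) * f (X j ω)) _ fun j _ =>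
    hX.integrable_comp (fun s t => f s * f t) i j]
  exact Finset.sum_congr rfl fun j _ => hX.integral_mul_comp hπ hK hrev i j f

end IsMarkovChain

/-- The autocovariances are mixtures of `θ ^ d` with total weight the variance of `g`, which is at
most `1`; `sum_pow_dist_le` bounds each component. -/
theorem averageVariance_le {S : Type*} [Fintype S] [DecidableEq S] {π : S → ℝ}
    {K : Matrix S S ℝ} (hπ : π ∈ stdSimplex ℝ S) (hK : K ∈ Matrix.rowStochastic ℝ S)
    (hrev : IsReversible π K) (hgap : secondEigenvalue K < 1) {g : S → ℝ}
    (hg : ∀ s, 0 ≤ g s ∧ g s ≤ 1) (N : ℕ) :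
    averageVariance π K g N ≤ 4 / (N * (1 - secondEigenvalue K)) := by
  set m := ∑ t, g t * π t with hm
  have hm0 : 0 ≤ m := Finset.sum_nonneg fun t _ => mul_nonneg (hg t).1 (hπ.1 t)
  have hm1 : m ≤ 1 := by
    rw [← hπ.2]
    exact Finset.sum_le_sum fun t _ => mul_le_of_le_one_left (hπ.1 t) (hg t).2
  have hf : ∑ s, π s * (g s - m) = 0 := by
    simp_rw [mul_sub]
    rw [Finset.sum_sub_distrib, ← Finset.sum_mul, hπ.2, one_mul, hm]
    simp_rw [mul_comm]
    simp
  obtain ⟨c, θ, hc, hθ, hcov⟩ := hrev.exists_autocovariance_eq hπ hK hgap hf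
  have hsum : ∑ i, c i ≤ 1 := by
    have := hcov 0
    simp only [pow_zero, one_mulVec, mul_one] at this
    rw [← this, ← hπ.2]
    refine Finset.sum_le_sum fun s _ => mul_le_of_le_one_right (hπ.1 s) ?_
    have := hg s
    nlinarith [abs_le.1 (abs_sub_le_of_nonneg_of_le this.1 this.2 hm0 hm1)]
  have h1 : 0 < 1 - secondEigenvalue K := by linarith
  have key : ∑ i ∈ Finset.range N, ∑ j ∈ Finset.range N, ∑ s, π s * ((g s - m) *
      (K ^ (i - j + (j - i)) *ᵥ fun r => g r - m) s) ≤ N * (4 / (1 - secondEigenvalue K)) := by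
    simp_rw [hcov]
    calc _ = ∑ k, c k * ∑ i ∈ Finset.range N, ∑ j ∈ Finset.range N, θ k ^ (i - j + (j - i)) := by
          simp_rw [Finset.mul_sum]
          rw [Finset.sum_comm]
          rw [Finset.sum_congr rfl fun j _ => Finset.sum_comm, Finset.sum_comm]
          refine Finset.sum_congr rfl fun k _ => Finset.sum_comm
      _ ≤ ∑ k, c k * (N * (4 / (1 - secondEigenvalue K))) := by
          refine Finset.sum_le_sum fun k _ => ?_
          rcases hθ k with h0 | ⟨h2, h3⟩
          · simp [h0]
          · refine mul_le_mul_of_nonneg_left ?_ (hc k)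
            refine (sum_pow_dist_le h2 (h3.trans_lt hgap) N).trans ?_
            gcongr
      _ ≤ 1 * (N * (4 / (1 - secondEigenvalue K))) := by
          rw [← Finset.sum_mul]
          exact mul_le_mul_of_nonneg_right hsum (by positivity)
      _ = _ := one_mul _
  rcases Nat.eq_zero_or_pos N with rfl | hN
  · simp [averageVariance]
  · rw [averageVariance, ← hm, div_le_iff₀ (by positivity)]
    refine key.trans (le_of_eq ?_)
    field_simp

/-! ### Independence of blocks, and tail bounds for bounded sums. -/

theorem iIndepFun_curry {ι κ Ω β : Type*} [MeasurableSpace β] [MeasurableSpace Ω] {μ : Measure Ω}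
    {X : ι × κ → Ω → β} (mX : ∀ c, Measurable (X c)) (h : iIndepFun X μ) :
    iIndepFun (fun i ω j => X (i, j) ω) μ := by
  have := h.isProbabilityMeasure
  have : ∀ c, IsProbabilityMeasure (μ.map (X c)) :=
    fun c => Measure.isProbabilityMeasure_map (mX c).aemeasurable
  have hs : iIndepFun (fun (p : (_ : ι) × κ) ω => X (p.1, p.2) ω) μ :=
    h.precomp (Equiv.sigmaEquivProd ι κ).injective
  have hc : (MeasurableEquiv.piCurry fun (_ : ι) (_ : κ) => β) ∘
      (fun ω (p : (_ : ι) × κ) => X (p.1, p.2) ω) = fun ω i j => X (i, j) ω := by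
    ext; simp [Sigma.curry]
  rw [iIndepFun_iff_map_fun_eq_infinitePi_map (by fun_prop), ← hc,
    ← Measure.map_map (by fun_prop) (by fun_prop),
    hs.map_fun_eq_infinitePi_map (by fun_prop)]
  rw [Measure.infinitePi_map_piCurry (fun i j => μ.map (X (i, j)))]
  congr 1
  ext1 i
  exact ((h.precomp (g := fun j => (i, j)) fun _ _ e => (Prod.mk.inj e).2).map_fun_eq_infinitePi_map
    (fun j => mX _)).symm

section Concentration

variable {Ω : Type*} [MeasurableSpace Ω] {μ : Measure Ω}

/-- The chord of `exp` over `[0, 2]`, with `e² ≤ 8`. -/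
theorem exp_two_mul_le {b : ℝ} (h0 : 0 ≤ b) (h1 : b ≤ 1) : Real.exp (2 * b) ≤ 1 + 7 * b := by
  have hc := convexOn_exp.2 (Set.mem_univ 0) (Set.mem_univ 2) (sub_nonneg.2 h1) h0
    (by ring : 1 - b + b = 1)
  have h2 : Real.exp 2 ≤ 8 := by
    have : Real.exp 2 = Real.exp 1 ^ 2 := by rw [← Real.exp_nat_mul]; norm_num
    rw [this]
    nlinarith [Real.exp_one_lt_d9, Real.exp_pos 1]
  simp only [smul_eq_mul, mul_zero, zero_add, Real.exp_zero, mul_one] at hc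
  rw [mul_comm]
  nlinarith

theorem integrable_of_mem_Icc [IsFiniteMeasure μ] {B : Ω → ℝ} (hm : Measurable B)
    {x y : ℝ} (hB : ∀ ω, x ≤ B ω ∧ B ω ≤ y) : Integrable B μ :=
  Integrable.of_mem_Icc x y hm.aemeasurable (.of_forall hB)

theorem memLp_two_of_mem_Icc [IsFiniteMeasure μ] {B : Ω → ℝ} (hm : Measurable B)
    {x y : ℝ} (hB : ∀ ω, x ≤ B ω ∧ B ω ≤ y) : MemLp B 2 μ :=
  memLp_of_bounded (.of_forall hB) hm.aestronglyMeasurable 2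

variable {ι : Type*} [Fintype ι] {B : ι → Ω → ℝ} {b : ℝ}

/-- Exponential Markov inequality with parameter `2`, which turns the threshold `log² n / 2` into
`exp (-log² n)`. -/
theorem measureReal_le_sum_le_exp (hind : iIndepFun B μ) (hm : ∀ i, Measurable (B i))
    (hB : ∀ i ω, 0 ≤ B i ω ∧ B i ω ≤ 1) (hb : ∀ i, ∫ ω, B i ω ∂μ = b) (x : ℝ) :
    μ.real {ω | x ≤ ∑ i, B i ω} ≤ Real.exp (-2 * x) * Real.exp (7 * (Fintype.card ι * b)) := by
  have := hind.isProbabilityMeasure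
  have hint : ∀ i, Integrable (fun ω => Real.exp (2 * B i ω)) μ := fun i =>
    integrable_of_mem_Icc (x := 0) (y := 8) (by have := hm i; fun_prop)
      fun ω => ⟨(Real.exp_pos _).le,
        (exp_two_mul_le (hB i ω).1 (hB i ω).2).trans (by linarith [(hB i ω).2])⟩
  have hmgf : ∀ i, mgf (B i) μ 2 ≤ Real.exp (7 * b) := fun i => by
    calc mgf (B i) μ 2 ≤ ∫ ω, (1 + 7 * B i ω) ∂μ :=
          integral_mono (hint i) ((integrable_const _).add
            ((integrable_of_mem_Icc (hm i) (hB i)).const_mul 7))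
            fun ω => exp_two_mul_le (hB i ω).1 (hB i ω).2
      _ = 7 * b + 1 := by
          rw [integral_add (integrable_const _) ((integrable_of_mem_Icc (hm i) (hB i)).const_mul 7),
            integral_const_mul, hb]
          simp [add_comm]
      _ ≤ _ := Real.add_one_le_exp _
  have h := measure_ge_le_exp_mul_mgf (μ := μ) (X := ∑ i, B i) (t := 2) x (by norm_num)
    (hind.integrable_exp_mul_sum hm fun i _ => hint i)
  simp only [Finset.sum_apply] at h
  refine h.trans (mul_le_mul_of_nonneg_left ?_ (Real.exp_pos _).le)
  rw [hind.mgf_sum hm]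
  calc ∏ i, mgf (B i) μ 2 ≤ ∏ _i : ι, Real.exp (7 * b) :=
        Finset.prod_le_prod (fun i _ => mgf_nonneg) fun i _ => hmgf i
    _ = _ := by
        rw [Finset.prod_const, Finset.card_univ, ← Real.exp_nat_mul]
        ring_nf

/-- Chebyshev; for values in `[0, 1]` one has `B² ≤ B`, so the mean dominates the variance. -/
theorem measureReal_sum_le_le (hind : iIndepFun B μ) (hm : ∀ i, Measurable (B i))
    (hB : ∀ i ω, 0 ≤ B i ω ∧ B i ω ≤ 1) (hb : ∀ i, ∫ ω, B i ω ∂μ = b) {x : ℝ}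
    (hx : x < Fintype.card ι * b) :
    μ.real {ω | ∑ i, B i ω ≤ x} ≤ Fintype.card ι * b / (Fintype.card ι * b - x) ^ 2 := by
  have := hind.isProbabilityMeasure
  have hL : ∀ i ∈ Finset.univ, MemLp (B i) 2 μ := fun i _ => memLp_two_of_mem_Icc (hm i) (hB i)
  have hmean : ∫ ω, (∑ i, B i) ω ∂μ = Fintype.card ι * b := by
    simp only [Finset.sum_apply]
    rw [integral_finsetSum _ fun i _ => integrable_of_mem_Icc (hm i) (hB i)]
    simp [hb]
  have hvar : variance (∑ i, B i) μ ≤ Fintype.card ι * b := by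
    rw [IndepFun.variance_sum hL fun i _ j _ hij => hind.indepFun hij]
    refine (Finset.sum_le_sum fun i _ => ?_).trans_eq (b := ∑ _i : ι, b) (by simp)
    refine (variance_le_expectation_sq (hm i).aestronglyMeasurable).trans ?_
    rw [← hb i]
    refine integral_mono ?_ (integrable_of_mem_Icc (hm i) (hB i)) fun ω => ?_
    · exact (hL i (Finset.mem_univ i)).integrable_sq
    · have := hB i ω
      simp only [Pi.pow_apply]
      nlinarith
  have hpos : 0 < Fintype.card ι * b - x := sub_pos.2 hx
  have h := meas_ge_le_variance_div_sq (μ := μ) (memLp_finsetSum' _ hL) hpos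
  rw [hmean] at h
  refine (measureReal_mono (s₂ := {ω | Fintype.card ι * b - x ≤
    |(∑ i, B i) ω - Fintype.card ι * b|}) fun ω hω => ?_).trans
    ((ENNReal.toReal_le_of_le_ofReal (by have := variance_nonneg (∑ i, B i) μ; positivity)
      h).trans (by gcongr))
  simp only [Set.mem_ofPred_eq, Finset.sum_apply] at hω ⊢
  rw [abs_sub_comm]
  exact (by linarith : _ ≤ _).trans (le_abs_self _)

end Concentration

/-! ### Testing the variance on one sample, estimating the mean on the other. -/

section TwoSamples

variable {n : ℕ}

/-- The sum of the squared differences of the first, second, … pair of the first sample. -/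
def spread (z : Fin 2 × Fin n → ℝ) : ℝ :=
  ∑ i : Fin (n / 2), (z (0, ⟨2 * i, by omega⟩) - z (0, ⟨2 * i + 1, by omega⟩)) ^ 2

/-- The mean of the second sample. -/
def center (z : Fin 2 × Fin n → ℝ) : ℝ := (∑ i, z (1, i)) / n

/-- The half width of the reported interval. -/
def halfWidth (n : ℕ) (β : ℝ) : ℝ := (√(2 / β) + Real.log (4 / β)) * (Real.log n / n)

theorem measurable_spread : Measurable (spread (n := n)) := by
  unfold spread
  fun_prop

variable {Ω : Type*} [MeasurableSpace Ω] {μ : Measure Ω} {Z : Fin 2 × Fin n → Ω → ℝ} {m v : ℝ}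
  (hind : iIndepFun Z μ) (hm : ∀ c, Measurable (Z c)) (hZ : ∀ c ω, 0 ≤ Z c ω ∧ Z c ω ≤ 1)
  (hmean : ∀ c, ∫ ω, Z c ω ∂μ = m) (hvar : ∀ c, ∫ ω, (Z c ω - m) ^ 2 ∂μ = v)

include hind hm in
theorem iIndepFun_sq_sub : iIndepFun (fun (i : Fin (n / 2)) ω =>
    (Z (0, ⟨2 * i, by omega⟩) ω - Z (0, ⟨2 * i + 1, by omega⟩) ω) ^ 2) μ := by
  have h1 : iIndepFun (fun (p : Fin (n / 2) × Fin 2) => Z (0, ⟨2 * p.1 + p.2, by omega⟩)) μ := by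
    refine hind.precomp (g := fun p : Fin (n / 2) × Fin 2 => ((0 : Fin 2),
      (⟨2 * p.1 + p.2, by omega⟩ : Fin n))) fun p q h => ?_
    have h := congrArg (fun c : Fin 2 × Fin n => (c.2 : ℕ)) h
    simp only at h
    ext <;> omega
  exact (iIndepFun_curry (fun _ => hm _) h1).comp (fun _ u => (u 0 - u 1) ^ 2)
    fun _ => by fun_prop

include hind hm hZ hmean hvar in
theorem integral_sq_sub {c c' : Fin 2 × Fin n} (h : c ≠ c') :
    ∫ ω, (Z c ω - Z c' ω) ^ 2 ∂μ = 2 * v := by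
  have := hind.isProbabilityMeasure
  have hc : ∀ c, Integrable (fun ω => Z c ω - m) μ := fun c =>
    (integrable_of_mem_Icc (hm c) (hZ c)).sub (integrable_const m)
  have hsq : ∀ c, Integrable (fun ω => (Z c ω - m) ^ 2) μ := fun c =>
    ((memLp_two_of_mem_Icc (hm c) (hZ c)).sub (memLp_const m)).integrable_sq
  have hi : IndepFun (fun ω => Z c ω - m) (fun ω => Z c' ω - m) μ :=
    (hind.indepFun h).comp (φ := fun x => x - m) (ψ := fun x => x - m) (by fun_prop) (by fun_prop)
  have h0 : ∀ c, ∫ ω, (Z c ω - m) ∂μ = 0 := fun c => by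
    rw [integral_sub (integrable_of_mem_Icc (hm c) (hZ c)) (integrable_const m), hmean]
    simp
  have hmul : ∫ ω, (Z c ω - m) * (Z c' ω - m) ∂μ = 0 := by
    rw [hi.integral_fun_mul_eq_mul_integral (hc c).aestronglyMeasurable
      (hc c').aestronglyMeasurable, h0, zero_mul]
  have hmi : Integrable (fun ω => (Z c ω - m) * (Z c' ω - m)) μ := hi.integrable_mul (hc c) (hc c')
  have e : ∀ ω, (Z c ω - Z c' ω) ^ 2 =
      (Z c ω - m) ^ 2 + (Z c' ω - m) ^ 2 - 2 * ((Z c ω - m) * (Z c' ω - m)) := fun ω => by ring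
  simp_rw [e]
  rw [integral_sub (f := fun ω => (Z c ω - m) ^ 2 + (Z c' ω - m) ^ 2) ((hsq c).add (hsq c')) (hmi.const_mul 2), integral_add (hsq c) (hsq c'),
    integral_const_mul, hmul, hvar, hvar]
  ring

include hind hm in
theorem indepFun_spread_center :
    IndepFun (fun ω => spread fun c => Z c ω) (fun ω => center fun c => Z c ω) μ := by
  have h := (iIndepFun_curry hm hind).indepFun (i := 0) (j := 1) (by decide)
  have hφ : Measurable fun u : Fin n → ℝ => ∑ i : Fin (n / 2),
    (u ⟨2 * i, by omega⟩ - u ⟨2 * i + 1, by omega⟩) ^ 2 := by fun_prop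
  have hψ : Measurable fun u : Fin n → ℝ => (∑ i, u i) / n := by fun_prop
  have := h.comp hφ hψ
  simp only [Function.comp_def] at this
  simpa only [spread, center] using this

include hind hm hZ hmean hvar in
theorem measureReal_le_abs_center_sub_le (hn : 0 < n) {h : ℝ} (hh : 0 < h) :
    μ.real {ω | h ≤ |center (fun c => Z c ω) - m|} ≤ v / (n * h ^ 2) := by
  have := hind.isProbabilityMeasure
  have hn' : (0 : ℝ) < n := by exact_mod_cast hn
  have hL : ∀ i ∈ (Finset.univ : Finset (Fin n)), MemLp (Z (1, i)) 2 μ := fun i _ =>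
    memLp_two_of_mem_Icc (hm _) (hZ _)
  have hE : ∫ ω, (∑ i, Z (1, i)) ω ∂μ = n * m := by
    simp only [Finset.sum_apply]
    rw [integral_finsetSum _ fun i _ => integrable_of_mem_Icc (hm _) (hZ _)]
    simp [hmean]
  have hV : variance (∑ i, Z (1, i)) μ = n * v := by
    rw [IndepFun.variance_sum hL fun i _ j _ hij => hind.indepFun fun e => hij (Prod.mk.inj e).2]
    have : ∀ i, variance (Z (1, i)) μ = v := fun i => by
      rw [variance_eq_integral (hm _).aemeasurable, hmean, hvar]
    simp [this]
  have hc := meas_ge_le_variance_div_sq (μ := μ) (memLp_finsetSum' _ hL) (mul_pos hn' hh)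
  rw [hE] at hc
  have hv0 := variance_nonneg (∑ i, Z (1, i)) μ
  refine (measureReal_mono (s₂ := {ω | n * h ≤
    |(∑ i, Z (1, i)) ω - n * m|}) fun ω hω => ?_).trans
    ((ENNReal.toReal_le_of_le_ofReal (by positivity) hc).trans ?_)
  · simp only [Set.mem_ofPred_eq, Finset.sum_apply, center] at hω ⊢
    have e : ∑ i, Z (1, i) ω - n * m = n * ((∑ i, Z (1, i) ω) / n - m) := by field_simp
    rw [e, abs_mul, abs_of_pos hn']
    gcongr
  · rw [hV]
    apply le_of_eq
    field_simp

include hind hm hZ hmean hvar in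
theorem measureReal_le_spread_le_exp (x : ℝ) :
    μ.real {ω | x ≤ spread fun c => Z c ω} ≤
      Real.exp (-2 * x) * Real.exp (7 * (((n / 2 : ℕ) : ℝ) * (2 * v))) := by
  have h := measureReal_le_sum_le_exp (iIndepFun_sq_sub hind hm)
    (fun i => by have := hm; fun_prop) (fun i ω => ?_) (fun i =>
      integral_sq_sub hind hm hZ hmean hvar (by simp)) x
  · simpa [spread] using h
  · have h1 := hZ (0, ⟨2 * i, by omega⟩) ω
    have h2 := hZ (0, ⟨2 * i + 1, by omega⟩) ω
    exact ⟨sq_nonneg _, by nlinarith⟩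

include hind hm hZ hmean hvar in
theorem measureReal_spread_le_le {x : ℝ} (hx : x < ((n / 2 : ℕ) : ℝ) * (2 * v)) :
    μ.real {ω | (spread fun c => Z c ω) ≤ x} ≤
      ((n / 2 : ℕ) : ℝ) * (2 * v) / (((n / 2 : ℕ) : ℝ) * (2 * v) - x) ^ 2 := by
  have h := measureReal_sum_le_le (iIndepFun_sq_sub hind hm)
    (fun i => by have := hm; fun_prop) (fun i ω => ?_) (fun i =>
      integral_sq_sub hind hm hZ hmean hvar (by simp)) (by simpa using hx)
  · simpa [spread] using h
  · have h1 := hZ (0, ⟨2 * i, by omega⟩) ω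
    have h2 := hZ (0, ⟨2 * i + 1, by omega⟩) ω
    exact ⟨sq_nonneg _, by nlinarith⟩

theorem sq_log_ge (hn : 5 ≤ n) : 3 / 2 ≤ Real.log n ^ 2 := by
  have h4 : Real.log 4 ≤ Real.log n := Real.log_le_log (by norm_num) (by exact_mod_cast (by omega))
  have : Real.log 4 = 2 * Real.log 2 := by
    rw [show (4 : ℝ) = 2 ^ 2 by norm_num, Real.log_pow]; norm_num
  nlinarith [Real.log_two_gt_d9]

/-- Chebyshev needs only the square-root term; the logarithmic one is slack. -/
theorem sqrt_mul_le_halfWidth {β : ℝ} (hβ : 0 < β) (hβ' : β ≤ 1) :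
    √(2 / β) * (Real.log n / n) ≤ halfWidth n β := by
  have h1 : 0 ≤ Real.log (4 / β) :=
    Real.log_nonneg (by rw [le_div_iff₀ hβ]; linarith)
  have h2 : 0 ≤ Real.log n / n := div_nonneg (Real.log_natCast_nonneg n) (Nat.cast_nonneg n)
  unfold halfWidth
  gcongr
  linarith

include hind hm hZ hmean hvar in
/-- With a probability of at most `β`, the spread of the first sample is small although the mean
of the second sample misses the true mean by more than the half width. -/
theorem measureReal_spread_le_and_lt_abs_center_sub_le (hn : 5 ≤ n) {β : ℝ} (hβ : 0 < β)
    (hβ' : β ≤ 1) :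
    μ.real {ω | (spread fun c => Z c ω) ≤ Real.log n ^ 2 / 2 ∧
      halfWidth n β < |center (fun c => Z c ω) - m|} ≤ β := by
  have := hind.isProbabilityMeasure
  set ℓ := Real.log n ^ 2 with hℓ
  have hℓ' : 3 / 2 ≤ ℓ := sq_log_ge hn
  have hn' : (5 : ℝ) ≤ n := by exact_mod_cast hn
  have hlog : 0 < Real.log n := Real.log_pos (by linarith)
  set h := √(2 / β) * (Real.log n / n) with hh
  have hhpos : 0 < h := by positivity
  have hhw : h ≤ halfWidth n β := sqrt_mul_le_halfWidth hβ hβ'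
  have hv0 : 0 ≤ v := by
    rw [← hvar (0, ⟨0, by omega⟩)]
    exact integral_nonneg fun ω => sq_nonneg _
  have hF : μ.real {ω | h ≤ |center (fun c => Z c ω) - m|} ≤ n * v / (2 * ℓ) * β := by
    refine (measureReal_le_abs_center_sub_le hind hm hZ hmean hvar (by omega) hhpos).trans_eq ?_
    have : h ^ 2 = 2 / β * (ℓ / n ^ 2) := by
      rw [hh, mul_pow, Real.sq_sqrt (by positivity), div_pow]
    rw [this]
    field_simp
  have hsub : {ω | (spread fun c => Z c ω) ≤ ℓ / 2 ∧ halfWidth n β <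
      |center (fun c => Z c ω) - m|} ⊆ (fun ω => spread fun c => Z c ω) ⁻¹' Set.Iic (ℓ / 2) ∩
      (fun ω => center fun c => Z c ω) ⁻¹' {x | h ≤ |x - m|} :=
    fun ω hω => ⟨hω.1, hhw.trans hω.2.le⟩
  have hprod : μ.real ((fun ω => spread fun c => Z c ω) ⁻¹' Set.Iic (ℓ / 2) ∩
      (fun ω => center fun c => Z c ω) ⁻¹' {x | h ≤ |x - m|}) =
      μ.real {ω | (spread fun c => Z c ω) ≤ ℓ / 2} *
        μ.real {ω | h ≤ |center (fun c => Z c ω) - m|} := by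
    simp only [measureReal_def, ← ENNReal.toReal_mul]
    rw [(indepFun_spread_center hind hm).measure_inter_preimage_eq_mul _ _ measurableSet_Iic
      (measurableSet_le (by fun_prop) (by fun_prop))]
    rfl
  refine (measureReal_mono hsub).trans ?_
  rw [hprod]
  -- For small variance the bound on the centre is already at most `β`. For large variance it
  -- exceeds `β` by the factor `n v / (2 ℓ)`, which the small probability of stopping absorbs.
  rcases le_or_gt (n * v) (2 * ℓ) with hr | hr
  · calc _ ≤ 1 * (n * v / (2 * ℓ) * β) :=
          mul_le_mul measureReal_le_one hF measureReal_nonneg zero_le_one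
      _ ≤ 1 * (1 * β) := by
          gcongr
          exact (div_le_one (by positivity)).2 hr
      _ = β := by ring
  · set M := ((n / 2 : ℕ) : ℝ) * (2 * v) with hM
    -- Pairing loses at most one chain, and `n - 1 ≥ 4 n / 5` because `n ≥ 5`.
    have h2 : (4 / 5 : ℝ) * n ≤ 2 * ((n / 2 : ℕ) : ℝ) := by
      have : (n : ℝ) ≤ 2 * ((n / 2 : ℕ) : ℝ) + 1 := by exact_mod_cast (by omega)
      linarith
    have hM1 : 4 / 5 * (n * v) ≤ M := by nlinarith
    have hE : μ.real {ω | (spread fun c => Z c ω) ≤ ℓ / 2} ≤ M / (M - ℓ / 2) ^ 2 :=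
      measureReal_spread_le_le hind hm hZ hmean hvar (by linarith)
    have hpos : 0 < M - ℓ / 2 := by linarith
    calc _ ≤ M / (M - ℓ / 2) ^ 2 * (n * v / (2 * ℓ) * β) :=
          mul_le_mul hE hF measureReal_nonneg (by have : 0 < M := by linarith
                                                  positivity)
      _ = (M * (n * v)) / ((M - ℓ / 2) ^ 2 * (2 * ℓ)) * β := by field_simp
      _ ≤ 1 * β := by
          gcongr
          rw [div_le_one (by positivity)]
          have a1 : M * (n * v) ≤ 5 / 4 * M ^ 2 := by nlinarith
          have a2 : 8 / 5 * ℓ ≤ M := by linarith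
          -- From `ℓ ≤ 5 M / 8`. The quotient is then at most `(5/4) (16/11)² / (2 ℓ)`, below `1`
          -- since `ℓ ≥ 3/2`.
          have a3 : (11 / 16 * M) ^ 2 ≤ (M - ℓ / 2) ^ 2 := by
            apply pow_le_pow_left₀ <;> linarith
          nlinarith [sq_nonneg M]
      _ = β := one_mul β

include hind hm hZ hmean hvar in
/-- If the variance is small then so is, very likely, the spread of the first sample. -/
theorem measureReal_lt_spread_le (hn : 5 ≤ n) (hv : n * v ≤ 1 / 12) :
    μ.real {ω | Real.log n ^ 2 / 2 < spread fun c => Z c ω} ≤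
      3 * (n : ℝ) * ((n : ℝ) + 1) * Real.exp (-(Real.log n) ^ 2) := by
  have := hind.isProbabilityMeasure
  have hn' : (5 : ℝ) ≤ n := by exact_mod_cast hn
  have hv0 : 0 ≤ v := by
    rw [← hvar (0, ⟨0, by omega⟩)]
    exact integral_nonneg fun ω => sq_nonneg _
  have h2 : 2 * ((n / 2 : ℕ) : ℝ) ≤ n := by exact_mod_cast (by omega)
  calc _ ≤ μ.real {ω | Real.log n ^ 2 / 2 ≤ spread fun c => Z c ω} :=
        measureReal_mono fun ω (hω : Real.log n ^ 2 / 2 < spread fun c => Z c ω) => hω.le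
    _ ≤ _ := measureReal_le_spread_le_exp hind hm hZ hmean hvar _
    _ = Real.exp (7 * (((n / 2 : ℕ) : ℝ) * (2 * v))) * Real.exp (-(Real.log n) ^ 2) := by
        rw [mul_comm]
        ring_nf
    _ ≤ 3 * (n : ℝ) * ((n : ℝ) + 1) * Real.exp (-(Real.log n) ^ 2) := by
        gcongr
        -- The exponent is at most `7 n v ≤ 7/12`.
        calc Real.exp (7 * (((n / 2 : ℕ) : ℝ) * (2 * v))) ≤ Real.exp 1 := by
              apply Real.exp_le_exp.2
              nlinarith
          _ ≤ 3 := by linarith [Real.exp_one_lt_d9]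
          _ ≤ _ := by nlinarith

end TwoSamples

/-! ### The procedure and its stopping level. -/

/-- The averages of the observed sequences. -/
def averages {ι : Type*} {N : ℕ} (w : ι → Fin N → ℝ) (c : ι) : ℝ := (∑ j, w c j) / N

theorem halfWidth_nonneg {n : ℕ} {β : ℝ} (hβ : 0 < β) (hβ' : β ≤ 1) : 0 ≤ halfWidth n β :=
  (mul_nonneg (Real.sqrt_nonneg _) (div_nonneg (Real.log_natCast_nonneg n)
    (Nat.cast_nonneg n))).trans (sqrt_mul_le_halfWidth hβ hβ')

/-- The procedure stops as soon as the spread of the averages over the first `n` sequences is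
small. If it is, the interval is centred at the mean of the averages over the other `n` sequences;
otherwise the trivial interval is reported. -/
def spreadProcedure (n : ℕ) (steps : ℕ → ℕ) (a : ℕ) {β : ℝ} (hβ : 0 < β) (hβ' : β ≤ 1) :
    Procedure (Fin 2 × Fin n) steps a where
  halt _ w := spread (averages w) ≤ Real.log n ^ 2 / 2
  lo _ w := if spread (averages w) ≤ Real.log n ^ 2 / 2 then
    center (averages w) - halfWidth n β else 0
  hi _ w := if spread (averages w) ≤ Real.log n ^ 2 / 2 then
    center (averages w) + halfWidth n β else 1
  lo_le_hi _ w := by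
    have := halfWidth_nonneg (n := n) hβ hβ'
    split_ifs <;> linarith

namespace Procedure

variable {ι : Type*} {steps : ℕ → ℕ} {a : ℕ} (P : Procedure ι steps a) (y : ι → ℕ → ℝ)

theorem level_le : P.level y ≤ a := Nat.sInf_le (Or.inl rfl)

theorem level_eq_or_halt : P.level y = a ∨ P.halt (P.level y) (P.seen y (P.level y)) :=
  Nat.sInf_mem (s := {k | k = a ∨ P.halt k (P.seen y k)}) ⟨a, Or.inl rfl⟩

theorem not_halt_of_lt_level {k : ℕ} (h : k < P.level y) : ¬ P.halt k (P.seen y k) :=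
  fun hk => Nat.notMem_of_lt_sInf h (Or.inr hk)

theorem measurable_level {Ω : Type*} [MeasurableSpace Ω] {y : Ω → ι → ℕ → ℝ}
    (h : ∀ k, MeasurableSet {ω | P.halt k (P.seen (y ω) k)}) :
    Measurable fun ω => P.level (y ω) := by
  classical
  have hne : ∀ ω, ∃ k, k = a ∨ P.halt k (P.seen (y ω) k) := fun ω => ⟨a, Or.inl rfl⟩
  have e : (fun ω => P.level (y ω)) = fun ω => Nat.find (hne ω) :=
    funext fun ω => ((Nat.find_eq_iff (hne ω)).2
      ⟨P.level_eq_or_halt (y ω), fun k hk => Nat.notMem_of_lt_sInf hk⟩).symm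
  rw [e]
  exact measurable_find hne fun k => (MeasurableSet.const (k = a)).union (h k)

end Procedure

theorem relaxationTime_eq_top {S : Type*} [Fintype S] [DecidableEq S] {K : Matrix S S ℝ}
    (h : 1 ≤ secondEigenvalue K) : relaxationTime K = ⊤ := by
  rw [relaxationTime, ENNReal.ofReal_of_nonpos (by linarith), ENNReal.inv_zero]

theorem relaxationTime_eq_ofReal {S : Type*} [Fintype S] [DecidableEq S] {K : Matrix S S ℝ}
    (h : secondEigenvalue K < 1) :
    relaxationTime K = ENNReal.ofReal (1 - secondEigenvalue K)⁻¹ := by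
  rw [relaxationTime, ENNReal.ofReal_inv_of_pos (by linarith)]

/-- Averages of the first `N` values of `g` along independent stationary chains form a sample of
independent variables with values in `[0, 1]` and with the same mean and variance. -/
theorem averages_properties {S : Type*} [Fintype S] [DecidableEq S] [MeasurableSpace S]
    [DiscreteMeasurableSpace S] {g : S → ℝ} (hg : ∀ s, 0 ≤ g s ∧ g s ≤ 1) {π : S → ℝ}
    (hπ : ∀ s, 0 ≤ π s) {K : Matrix S S ℝ} (hK : K ∈ Matrix.rowStochastic ℝ S)
    (hrev : IsReversible π K) {Ω : Type*} [MeasurableSpace Ω] {μ : Measure Ω}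
    [IsProbabilityMeasure μ] {ι : Type*} {X : ι → ℕ → Ω → S}
    (hX : ∀ c, IsMarkovChain μ π K (X c)) (hind : iIndepFun (fun c ω j => X c j ω) μ)
    {N : ℕ} (hN : 0 < N) {Z : ι → Ω → ℝ}
    (hZ : ∀ c ω, Z c ω = averages (fun c (j : Fin N) => g (X c j ω)) c) :
    iIndepFun Z μ ∧ (∀ c, Measurable (Z c)) ∧ (∀ c ω, 0 ≤ Z c ω ∧ Z c ω ≤ 1) ∧
      (∀ c, ∫ ω, Z c ω ∂μ = ∑ s, g s * π s) ∧
      ∀ c, ∫ ω, (Z c ω - ∑ s, g s * π s) ^ 2 ∂μ = averageVariance π K g N := by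
  obtain rfl : Z = fun c ω => averages (fun c (j : Fin N) => g (X c j ω)) c :=
    funext fun c => funext fun ω => hZ c ω
  have hN' : (0 : ℝ) < N := by exact_mod_cast hN
  have hgm : Measurable g := measurable_of_finite g
  have hav : Measurable fun u : ℕ → S => (∑ j : Fin N, g (u j)) / (N : ℝ) := by fun_prop
  have hi := hind.comp (fun _ u => (∑ j : Fin N, g (u j)) / (N : ℝ)) fun _ => hav
  refine ⟨hi, fun c => hav.comp (measurable_pi_lambda _ (hX c).measurable), fun c ω => ⟨?_, ?_⟩,
    fun c => (hX c).integral_average hπ hK hrev g N hN,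
    fun c => (hX c).integral_average_sub_sq hπ hK hrev g N hN⟩
  · exact div_nonneg (Finset.sum_nonneg fun j _ => (hg _).1) hN'.le
  · refine (div_le_one hN').2 ((Finset.sum_le_sum fun j _ => (hg _).2).trans ?_)
    simp

end AdaptiveMCMC

end

/-! ### Assembly of the three claims. -/

theorem theorem2 (n : ℕ) (hn : 5 ≤ n) (α : ℝ) (hα₀ : 0 < α) (hα₁ : α < 1)
    (τhat : ℝ) (hτ : 1 ≤ τhat) (a : ℕ) :
    -- one procedure, fixed before the chain and the function `g` are given; at level `k` it has
    -- run each of the `2 n` chains for `⌊n 2 ^ k τhat⌋` steps and has seen the values of `g` there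
    ∃ P : AdaptiveMCMC.Procedure (Fin 2 × Fin n) (fun k => ⌊(n : ℝ) * (2 ^ k * τhat)⌋₊) a,
      ∀ (S : Type*) [Fintype S] [DecidableEq S] [MeasurableSpace S] [DiscreteMeasurableSpace S]
        (g : S → ℝ) (_hg : ∀ s, 0 ≤ g s ∧ g s ≤ 1)
        (π : S → ℝ) (_hπ : π ∈ stdSimplex ℝ S)
        (K : Matrix S S ℝ) (_hK : K ∈ Matrix.rowStochastic ℝ S)
        (_hrev : AdaptiveMCMC.IsReversible π K)
        (Ω : Type*) [MeasurableSpace Ω] (μ : Measure Ω) [IsProbabilityMeasure μ]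
        -- `2 n` independent chains, each started from an exact sample `X c 0` of `π`
        (X : Fin 2 × Fin n → ℕ → Ω → S)
        (_hX : ∀ c, AdaptiveMCMC.IsMarkovChain μ π K (X c))
        (_hind : iIndepFun (fun c ω j => X c j ω) μ)
        (y : Ω → Fin 2 × Fin n → ℕ → ℝ) (_hy : ∀ ω c j, y ω c j = g (X c j ω))
        (M : Ω → ℝ) (_hM : ∀ ω, M ω = 2 ^ P.level (y ω) * τhat)
        (gbar : ℝ) (_hgbar : gbar = ∑ s, g s * π s),
        -- the random step budget `M`, and the number of steps of each of the `2 n` chains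
        (Measurable M ∧ (∀ ω, ∃ k ≤ a, M ω = 2 ^ k * τhat) ∧
          ∀ ω, P.stepsUsed (y ω) = ⌊(n : ℝ) * M ω⌋₊) ∧
        -- validity
        μ {ω | gbar ∉ Set.Icc (P.left (y ω)) (P.right (y ω))} ≤ ENNReal.ofReal α ∧
        -- length
        (∀ ω, 1 ≤ M ω / τhat → M ω / τhat < 2 ^ a →
          P.right (y ω) - P.left (y ω) ≤
            2 * (√(2 * ((a : ℝ) + 1) / α) + Real.log (4 * ((a : ℝ) + 1) / α)) *
              (Real.log n / n)) ∧
        -- number of steps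
        μ {ω | 96 * max (AdaptiveMCMC.relaxationTime K) (ENNReal.ofReal τhat)
                < ENNReal.ofReal (M ω)} ≤
          ENNReal.ofReal (3 * (n : ℝ) * ((n : ℝ) + 1) * Real.exp (-(Real.log n) ^ 2)) := by
  set β : ℝ := α / ((a : ℝ) + 1) with hβdef
  have ha : (0 : ℝ) < (a : ℝ) + 1 := by positivity
  have hβ : 0 < β := div_pos hα₀ ha
  have hβ' : β ≤ 1 := by
    rw [hβdef, div_le_one ha]
    linarith [(Nat.cast_nonneg a : (0 : ℝ) ≤ a)]
  refine ⟨AdaptiveMCMC.spreadProcedure n _ a hβ hβ', ?_⟩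
  intro S _ _ _ _ g hg π hπ K hK hrev Ω _ μ _ X hX hind y hy M hM gbar hgbar
  set steps : ℕ → ℕ := fun k => ⌊(n : ℝ) * (2 ^ k * τhat)⌋₊ with hsteps
  set P := AdaptiveMCMC.spreadProcedure n steps a hβ hβ' with hP
  let Z : ℕ → Fin 2 × Fin n → Ω → ℝ := fun k c ω => AdaptiveMCMC.averages (P.seen (y ω) k) c
  -- After `steps k` steps, `steps k + 1` states have been seen, including the initial one.
  have hZ : ∀ k, _ := fun k => AdaptiveMCMC.averages_properties hg hπ.1 hK hrev hX hind
    (Nat.succ_pos (steps k)) (Z := Z k) fun c ω => by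
      simp only [Z, AdaptiveMCMC.averages, AdaptiveMCMC.Procedure.seen, hy]
  rw [← hgbar] at hZ
  have hgbar01 : 0 ≤ gbar ∧ gbar ≤ 1 := by
    rw [hgbar]
    refine ⟨Finset.sum_nonneg fun s _ => mul_nonneg (hg s).1 (hπ.1 s), ?_⟩
    rw [← hπ.2]
    exact Finset.sum_le_sum fun s _ => mul_le_of_le_one_left (hπ.1 s) (hg s).2
  have hhalt : ∀ k ω, P.halt k (P.seen (y ω) k) ↔
      AdaptiveMCMC.spread (fun c => Z k c ω) ≤ Real.log n ^ 2 / 2 := fun k ω => Iff.rfl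
  have hleft : ∀ ω, P.left (y ω) =
      if AdaptiveMCMC.spread (fun c => Z (P.level (y ω)) c ω) ≤ Real.log n ^ 2 / 2 then
        AdaptiveMCMC.center (fun c => Z (P.level (y ω)) c ω) - AdaptiveMCMC.halfWidth n β
      else 0 := fun ω => rfl
  have hright : ∀ ω, P.right (y ω) =
      if AdaptiveMCMC.spread (fun c => Z (P.level (y ω)) c ω) ≤ Real.log n ^ 2 / 2 then
        AdaptiveMCMC.center (fun c => Z (P.level (y ω)) c ω) + AdaptiveMCMC.halfWidth n β
      else 1 := fun ω => rfl
  have hτ₀ : 0 < τhat := by linarith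
  refine ⟨⟨?_, fun ω => ⟨_, P.level_le (y ω), hM ω⟩, fun ω => by rw [hM ω]; rfl⟩, ?_, ?_, ?_⟩
  · have hlev : Measurable fun ω => P.level (y ω) := by
      refine P.measurable_level fun k => ?_
      simp only [hhalt]
      exact measurableSet_le (AdaptiveMCMC.measurable_spread.comp
        (measurable_pi_lambda _ (hZ k).2.1)) measurable_const
    rw [funext hM]
    exact (measurable_from_nat (f := fun k => 2 ^ k * τhat)).comp hlev
  · have hsub : {ω | gbar ∉ Set.Icc (P.left (y ω)) (P.right (y ω))} ⊆
        ⋃ k ∈ Finset.range (a + 1), {ω | AdaptiveMCMC.spread (fun c => Z k c ω) ≤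
          Real.log n ^ 2 / 2 ∧ AdaptiveMCMC.halfWidth n β <
            |AdaptiveMCMC.center (fun c => Z k c ω) - gbar|} := by
      intro ω hω
      have hω : gbar ∉ Set.Icc (P.left (y ω)) (P.right (y ω)) := hω
      simp only [Set.mem_iUnion]
      refine ⟨P.level (y ω), Finset.mem_range.2 (Nat.lt_succ_of_le (P.level_le _)), ?_⟩
      rw [hleft, hright] at hω
      split_ifs at hω with h
      · refine ⟨h, ?_⟩
        by_contra! hle
        exact hω ⟨by linarith [(abs_le.1 hle).2], by linarith [(abs_le.1 hle).1]⟩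
      -- The trivial interval `[0, 1]` never misses.
      · exact absurd hgbar01 hω
    calc _ ≤ ∑ k ∈ Finset.range (a + 1), μ {ω | AdaptiveMCMC.spread (fun c => Z k c ω) ≤
          Real.log n ^ 2 / 2 ∧ AdaptiveMCMC.halfWidth n β <
            |AdaptiveMCMC.center (fun c => Z k c ω) - gbar|} :=
          (measure_mono hsub).trans (measure_biUnion_finset_le _ _)
      _ ≤ ∑ k ∈ Finset.range (a + 1), ENNReal.ofReal β := by
          refine Finset.sum_le_sum fun k _ => ?_
          obtain ⟨h1, h2, h3, h4, h5⟩ := hZ k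
          rw [← ofReal_measureReal]
          exact ENNReal.ofReal_le_ofReal
            (AdaptiveMCMC.measureReal_spread_le_and_lt_abs_center_sub_le h1 h2 h3 h4 h5 hn hβ hβ')
      _ = ENNReal.ofReal α := by
          rw [← ENNReal.ofReal_sum_of_nonneg fun _ _ => hβ.le, Finset.sum_const, Finset.card_range,
            nsmul_eq_mul, hβdef]
          congr 1
          push_cast
          field_simp
  · intro ω _ hlt
    rw [hM ω, mul_div_cancel_right₀ _ hτ₀.ne'] at hlt
    have hlev : P.level (y ω) ≠ a := fun h => by rw [h] at hlt; exact lt_irrefl _ hlt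
    have h := (P.level_eq_or_halt (y ω)).resolve_left hlev
    rw [hhalt] at h
    rw [hleft, hright, if_pos h, if_pos h, AdaptiveMCMC.halfWidth, hβdef,
      div_div_eq_mul_div, div_div_eq_mul_div]
    apply le_of_eq
    ring
  · rcases le_or_gt 1 (AdaptiveMCMC.secondEigenvalue K) with hgap | hgap
    -- With `τ₂ = ∞` the event is empty.
    · simp [AdaptiveMCMC.relaxationTime_eq_top hgap]
    set t := (1 - AdaptiveMCMC.secondEigenvalue K)⁻¹ with ht
    have ht₀ : 0 < t := inv_pos.2 (by linarith)
    have hτt : τhat ≤ max t τhat := le_max_right _ _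
    have hex : ∃ k, 48 * max t τhat < 2 ^ k * τhat := by
      obtain ⟨k, hk⟩ := pow_unbounded_of_one_lt (48 * max t τhat) (one_lt_two (α := ℝ))
      exact ⟨k, hk.trans_le (le_mul_of_one_le_right (by positivity) hτ)⟩
    classical
    set k := Nat.find hex with hk
    obtain ⟨h1, h2, h3, h4, h5⟩ := hZ k
    have hsub : {ω | 96 * max (AdaptiveMCMC.relaxationTime K) (ENNReal.ofReal τhat)
        < ENNReal.ofReal (M ω)} ⊆
        {ω | Real.log n ^ 2 / 2 < AdaptiveMCMC.spread fun c => Z k c ω} := by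
      intro ω hω
      have hω : 96 * max (AdaptiveMCMC.relaxationTime K) (ENNReal.ofReal τhat)
        < ENNReal.ofReal (M ω) := hω
      rw [AdaptiveMCMC.relaxationTime_eq_ofReal hgap, ← ENNReal.ofReal_max,
        show (96 : ENNReal) = ENNReal.ofReal 96 by norm_num,
        ← ENNReal.ofReal_mul (by norm_num),
        ENNReal.ofReal_lt_ofReal_iff_of_nonneg (by positivity), hM ω] at hω
      -- Stopping at level `0` would give `M = τhat`, too small. Otherwise the level before the last
      -- already exceeds `48 max(t, τhat)`, so by minimality `k` is at most that level.
      have hlt : k < P.level (y ω) := by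
        cases hT : P.level (y ω) with
        | zero =>
          rw [hT] at hω
          linarith
        | succ T =>
          rw [hT, pow_succ] at hω
          exact Nat.lt_succ_of_le (Nat.find_min' hex (by linarith))
      have := P.not_halt_of_lt_level (y ω) hlt
      rw [hhalt] at this
      exact not_le.1 this
    have hv : (n : ℝ) * AdaptiveMCMC.averageVariance π K g (steps k + 1) ≤ 1 / 12 := by
      have hn₀ : (0 : ℝ) < n := by exact_mod_cast (by omega)
      -- The extra initial state compensates for the floor.
      have hN : 48 * (n * t) ≤ ((steps k + 1 : ℕ) : ℝ) := by
        have e1 : (n : ℝ) * (2 ^ k * τhat) < ((steps k + 1 : ℕ) : ℝ) := by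
          push_cast
          exact Nat.lt_floor_add_one _
        have e2 : n * (48 * t) ≤ n * (2 ^ k * τhat) :=
          mul_le_mul_of_nonneg_left (by linarith [Nat.find_spec hex, le_max_left t τhat]) hn₀.le
        linarith
      calc (n : ℝ) * AdaptiveMCMC.averageVariance π K g (steps k + 1)
          ≤ n * (4 / (((steps k + 1 : ℕ) : ℝ) * (1 - AdaptiveMCMC.secondEigenvalue K))) :=
            mul_le_mul_of_nonneg_left
              (AdaptiveMCMC.averageVariance_le hπ hK hrev hgap hg _) hn₀.le
        _ = 4 * (n * t) / ((steps k + 1 : ℕ) : ℝ) := by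
            rw [ht]
            have : 1 - AdaptiveMCMC.secondEigenvalue K ≠ 0 := by linarith
            field_simp
        _ ≤ 4 * (n * t) / (48 * (n * t)) := by gcongr
        _ = 1 / 12 := by field_simp; norm_num
    refine (measure_mono hsub).trans ?_
    rw [← ofReal_measureReal]
    exact ENNReal.ofReal_le_ofReal
      (AdaptiveMCMC.measureReal_lt_spread_le h1 h2 h3 h4 h5 hn hv)
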